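/- Let $X$ and $Z$ be real locally convex topological vector spaces with topological duals $X^*$, $Z^*$, where $X^*$ carries the weak* topology. Let $K\subseteq Z$ be a convex cone with $0\in K$ and $\operatorname{int}K\neq\emptyset$, and let $K^\circ=\{z^*\in Z^*:\langle z^*,k\rangle\ge 0\ \forall k\in K\}$. Let $\mathcal G(Z,K)$ be the set of all closed convex $A\subseteq Z$ with $A+K=A$ (including $\emptyset$), ordered by $A\leqslant B\iff A\supseteq B$; it is a complete lattice with $\sup A_i=\bigcap A_i$ and $\inf A_i=\operatorname{cl}\operatorname{co}\bigcup A_i$. In $\mathcal G(Z,K)$ sums are understood as $\operatorname{cl}\operatorname{co}(A+B)$ (empty if a summand is empty). Write $z<w$ if $w-z\in\operatorname{int}K$, and $A<z$ if $w\in A$ for some $w<z$. Let $F:X\to\mathcal G(Z,K)$ be convex, i.e. $F(\lambda x+(1-\lambda)y)\leqslant\lambda F(x)+(1-\lambda)F(y)$ for $x,y\in X$, $\lambda\in(0,1)$; lower level-closed, i.e. $\{x:z\in F(x)\}$ is closed for every $z\in Z$; and proper, i.e. $F(x)\ne\emptyset$ for some $x$ and $F(x)\neq Z$ for all $x$. For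 $x^*\in X^*$, $z^*\in K^\circ\setminus\{0\}$, $s\in\mathbb R$ put $$S(z^*,s)=\{z\in Z: s\le\langle z^*,z\rangle\},\qquad -G(x^*,z^*)=\inf_{x\in X}\{F(x)+S(z^*,-\langle x^*,x\rangle)\}.$$ A risk function is a map $R:X^*\times\mathbb R\to\mathcal G(Z,K)$ such that $R(x^*,\cdot)$ is increasing and left-continuous ($R(x^*,s)=\sup_{t<s}R(x^*,t)$) for each $x^*$. It is called maximal if, in addition, (a) it is jointly quasiconcave, i.e. $R(\lambda x^*+(1-\lambda)y^*,\lambda s+(1-\lambda)r)\subseteq R(x^*,s)\cup R(y^*,r)$ for $\lambda\in(0,1)$, and $R(\lambda x^*,s)=R(x^*,s/\lambda)$ for $\lambda>0$; (b) with $R^+(x^*,s)=\inf_{t>s}R(x^*,t)$, the set $\{x^*:R^+(x^*,s)<z\}$ is open for all $s\in\mathbb R$, $z\in Z$; (c) $\inf_{s\in\mathbb R}R(x^*,s)$ is the same for all $x^*\in X^*$. We say that $R$ represents $F$ if $F(x)=\sup_{x^*\in X^*}R(x^*,\langle x^*,x\rangle)$ for all $x\in X$. **Theorem.** (1) For every $x\in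 X$, $$F(x)=\sup_{x^*\in X^*}\ \sup_{z^*\in K^\circ\setminus\{0\}}\{-G(x^*,z^*)+S(z^*,\langle x^*,x\rangle)\}.$$ (2) There is a maximal risk function $R$ that represents $F$ and satisfies $\tilde R\leqslant R$ for every risk function $\tilde R$ that represents $F$ (this determines $R$ uniquely); every maximal risk function that represents $F$ coincides with $R$ on $(X^*\setminus\{0\})\times\mathbb R$. Moreover, $$R(x^*,s)=\sup_{z^*\in K^\circ\setminus\{0\}}\{-G(x^*,z^*)+S(z^*,s)\},\qquad s\in\mathbb R,$$ for every $x^*\in X^*$ such that $-G(x^*,z^*)\neq Z$ for some $z^*\in K^\circ\setminus\{0\}$. -/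

import Mathlib

open scoped Pointwise

namespace SetValued

section Image

variable {Z : Type*} [AddCommGroup Z] [Module ℝ Z] [TopologicalSpace Z]

/-- The closed, convex, monotone subsets of `Z`, i.e. the sets `A` with `A + K = A`, `co A = A`
and `cl A = A`.  The order of this complete lattice is reverse inclusion:
`A ≤ B` means `B ⊆ A`, and `A ≤ z` (for a point `z`) means `z ∈ A`. -/
def monotoneClosedConvex (K : PointedCone ℝ Z) : Set (Set Z) :=
  {A | A + (K : Set Z) = A ∧ Convex ℝ A ∧ IsClosed A}

/-- The infimum `cl co ⋃ Aᵢ` of a family of closed convex monotone sets. -/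
def latticeInf {ι : Sort*} (A : ι → Set Z) : Set Z :=
  closure (convexHull ℝ (⋃ i, A i))

/-- The supremum `⋂ Aᵢ` of a family of closed convex monotone sets. -/
def latticeSup {ι : Sort*} (A : ι → Set Z) : Set Z :=
  ⋂ i, A i

/-- The sum `cl co (A + B)` of closed convex monotone sets; it is empty if a summand is. -/
def closedSum (A B : Set Z) : Set Z :=
  closure (convexHull ℝ (A + B))

/-- The polar cone `K° = {z* ∈ Z* : ⟨z*, k⟩ ≥ 0 for all k ∈ K}`. -/
def polarCone (K : PointedCone ℝ Z) : Set (WeakDual ℝ Z) :=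
  {zs | ∀ k ∈ K, 0 ≤ zs k}

/-- The strict order `z < w`, i.e. `w - z ∈ int K`. -/
def StrictlyBelow (K : PointedCone ℝ Z) (z w : Z) : Prop :=
  w - z ∈ interior (K : Set Z)

/-- The half space `S(z*, s) = {z : s ≤ ⟨z*, z⟩}`. -/
def halfSpace (zs : WeakDual ℝ Z) (s : ℝ) : Set Z :=
  {z | s ≤ zs z}

end Image

section Functions

variable {X Z : Type*} [AddCommGroup X] [Module ℝ X] [TopologicalSpace X]
  [AddCommGroup Z] [Module ℝ Z] [TopologicalSpace Z]

/-- `F (t x + (1 - t) y) ≤ t F x + (1 - t) F y` for the order given by reverse inclusion. -/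
def IsConvexFun (F : X → Set Z) : Prop :=
  ∀ x y : X, ∀ t : ℝ, 0 < t → t < 1 →
    closedSum (t • F x) ((1 - t) • F y) ⊆ F (t • x + (1 - t) • y)

/-- All the lower level sets `{x : F x ≤ z} = {x : z ∈ F x}` are closed. -/
def IsLowerLevelClosed (F : X → Set Z) : Prop :=
  ∀ z : Z, IsClosed {x | z ∈ F x}

/-- `F x ≠ ∅` for some `x`, and `F x ≠ Z` for all `x`. -/
def IsProper (F : X → Set Z) : Prop :=
  (∃ x, F x ≠ ∅) ∧ ∀ x, F x ≠ Set.univ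

/-- The negative set-valued conjugate `-G(x*, z*) = inf_x (F x + S(z*, -⟨x*, x⟩))`. -/
def negConjugate (F : X → Set Z) (xs : WeakDual ℝ X) (zs : WeakDual ℝ Z) : Set Z :=
  latticeInf fun x : X => closedSum (F x) (halfSpace zs (-(xs x)))

/-- Risk functions: functions of `(x*, s)` with closed convex monotone values which are increasing
and left-continuous in `s`, that is, `R(x*, s) = sup_{t < s} R(x*, t)`. -/
structure IsRiskFunction (K : PointedCone ℝ Z) (R : WeakDual ℝ X → ℝ → Set Z) : Prop where
  mem : ∀ xs s, R xs s ∈ monotoneClosedConvex K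
  increasing : ∀ xs s t, s ≤ t → R xs t ⊆ R xs s
  left_continuous : ∀ xs s, R xs s = latticeSup fun t : Set.Iio s => R xs t

/-- The right-continuous version `R⁺(x*, s) = inf_{s < t} R(x*, t)`. -/
def rightVersion (R : WeakDual ℝ X → ℝ → Set Z) (xs : WeakDual ℝ X) (s : ℝ) : Set Z :=
  latticeInf fun t : Set.Ioi s => R xs t

/-- Maximal risk functions.  The topology of `X*` is the weak-star one. -/
structure IsMaximalRiskFunction (K : PointedCone ℝ Z) (R : WeakDual ℝ X → ℝ → Set Z) : Prop
    extends IsRiskFunction K R where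
  /-- Joint quasiconcavity; the infimum of two monotone sets is their union. -/
  quasiconcave : ∀ (xs ys : WeakDual ℝ X) (s r t : ℝ), 0 < t → t < 1 →
    R (t • xs + (1 - t) • ys) (t * s + (1 - t) * r) ⊆ R xs s ∪ R ys r
  homogeneous : ∀ (xs : WeakDual ℝ X) (s t : ℝ), 0 < t → R (t • xs) s = R xs (s / t)
  /-- `{x* : R⁺(x*, s) < z}` is open, where `A < z` means `w ∈ A` for some `w < z`. -/
  isOpen : ∀ (s : ℝ) (z : Z),
    IsOpen {xs : WeakDual ℝ X | ∃ w, StrictlyBelow K w z ∧ w ∈ rightVersion R xs s}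
  /-- The infimum of `R(x*, s)` over all `s` does not depend on `x*`. -/
  asymptotic : ∀ xs ys : WeakDual ℝ X,
    (latticeInf fun s : ℝ => R xs s) = latticeInf fun s : ℝ => R ys s

/-- `F x = sup_{x*} R(x*, ⟨x*, x⟩)` for all `x`. -/
def Represents (R : WeakDual ℝ X → ℝ → Set Z) (F : X → Set Z) : Prop :=
  ∀ x, F x = latticeSup fun xs : WeakDual ℝ X => R xs (xs x)

end Functions

end SetValued

/-!
Since `int K` is nonempty, closures can be avoided: `A < z` is an open condition, and every point
of an open set lies strictly below another one. In particular the graph of `F` is closed.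

The greatest risk function representing `F` is the left-continuous version of
`t ↦ cl ⋃ {F y : t ≤ ⟨x*, y⟩}` (`greatestRisk`). It lies above any other one because
`F y ⊆ R'(x*, ⟨x*, y⟩) ⊆ R'(x*, t)` whenever `t ≤ ⟨x*, y⟩`. It represents `F` because the level
sets `{y : z ∈ F y}` are closed and convex, hence intersections of half spaces, and the properties
of a maximal risk function can be read off its definition.

For a maximal risk function `R'` representing `F` and a point `z`, the pairs `(x*, s)` with
`R'⁺(x*, s) < z` form an open set whose complement is a convex cone in `X* × ℝ`. As continuous
functionals on the weak-star dual are evaluations at points of `X`, the bipolar theorem shows that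
for `x* ≠ 0` such an `s` is at most the supremum of `x*` over `{y : z ∈ F y}`
(`exists_lt_of_mem_strictHypograph`). This gives `R' = greatestRisk F` away from `x* = 0`. The
asymptotic condition guarantees that the level set is nonempty.

The dual formulas come from the Hahn–Banach theorem. The set `-G(x*, z*) + S(z*, s)` is a half space
orthogonal to `z*`, or everything; it contains `greatestRisk F x* s`. For the reverse inclusions, a
point is separated from the closed convex graph of `F` (`exists_affine_minorant_of_notMem`),
respectively from the set of all `(r, w)` with `r ≤ ⟨x*, y⟩` and `w ∈ F y` for some `y`
(`exists_separation_of_notMem_greatestRisk`). In both cases the separating functional is perturbed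
by a fixed affine minorant of `F`, which rules out degenerate functionals; such a minorant exists by
properness in the first case and by hypothesis in the second.
-/

namespace SetValued

section Image

variable {Z : Type*} [AddCommGroup Z] [Module ℝ Z] [TopologicalSpace Z]

/-! ### Monotone sets, half spaces and the strict order -/

lemma add_mem_of_mem_monotoneClosedConvex {K : PointedCone ℝ Z} {A : Set Z}
    (hA : A ∈ monotoneClosedConvex K) {a k : Z} (ha : a ∈ A) (hk : k ∈ K) : a + k ∈ A := by
  rw [← hA.1]
  exact Set.add_mem_add ha hk

lemma mem_of_strictlyBelow {K : PointedCone ℝ Z} {A : Set Z} (hA : A ∈ monotoneClosedConvex K)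
    {w z : Z} (hw : w ∈ A) (hwz : StrictlyBelow K w z) : z ∈ A := by
  have := add_mem_of_mem_monotoneClosedConvex hA hw (interior_subset hwz)
  rwa [add_sub_cancel] at this

lemma mem_monotoneClosedConvex_of {K : PointedCone ℝ Z} {A : Set Z}
    (hadd : ∀ a ∈ A, ∀ k ∈ K, a + k ∈ A) (hconv : Convex ℝ A) (hclosed : IsClosed A) :
    A ∈ monotoneClosedConvex K := by
  refine ⟨Set.Subset.antisymm ?_ fun a ha => ?_, hconv, hclosed⟩
  · rintro _ ⟨a, ha, k, hk, rfl⟩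
    exact hadd a ha k hk
  · exact ⟨a, ha, 0, K.zero_mem, add_zero a⟩

lemma exists_apply_eq_one {zs : WeakDual ℝ Z} (hzs : zs ≠ 0) : ∃ h : Z, zs h = 1 := by
  obtain ⟨h, hh⟩ : ∃ h, zs h ≠ 0 := by
    by_contra! H
    exact hzs (DFunLike.ext _ _ fun x => H x)
  refine ⟨(zs h)⁻¹ • h, ?_⟩
  rw [map_smul, smul_eq_mul, inv_mul_cancel₀ hh]

lemma isClosed_halfSpace (zs : WeakDual ℝ Z) (s : ℝ) : IsClosed (halfSpace zs s) :=
  isClosed_le continuous_const (map_continuous zs)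

lemma convex_halfSpace (zs : WeakDual ℝ Z) (s : ℝ) : Convex ℝ (halfSpace zs s) := by
  intro a ha b hb p q hp hq hpq
  simp only [halfSpace, Set.mem_ofPred_eq, map_add, map_smul, smul_eq_mul] at *
  calc s = p * s + q * s := by rw [← add_mul, hpq, one_mul]
    _ ≤ _ := by gcongr

lemma closedSum_subset_halfSpace {A B : Set Z} {zs : WeakDual ℝ Z} {a b : ℝ}
    (hA : A ⊆ halfSpace zs a) (hB : B ⊆ halfSpace zs b) :
    closedSum A B ⊆ halfSpace zs (a + b) := by
  refine closure_minimal (convexHull_min ?_ (convex_halfSpace _ _)) (isClosed_halfSpace _ _)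
  rintro _ ⟨x, hx, y, hy, rfl⟩
  simpa [halfSpace] using add_le_add (hA hx) (hB hy)

lemma smul_mem_interior_cone [ContinuousSMul ℝ Z] {K : PointedCone ℝ Z} {k : Z}
    (hk : k ∈ interior (K : Set Z)) {c : ℝ} (hc : 0 < c) : c • k ∈ interior (K : Set Z) := by
  have h : c • k ∈ interior (c • (K : Set Z)) := by
    rw [interior_smul₀ hc.ne']
    exact Set.smul_mem_smul_set hk
  refine interior_mono ?_ h
  rintro _ ⟨y, hy, rfl⟩
  exact PointedCone.smul_mem K hc.le hy

variable [IsTopologicalAddGroup Z]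

lemma exists_strictlyBelow_of_mem_closure {K : PointedCone ℝ Z} {U : Set Z} {w z : Z}
    (hw : w ∈ closure U) (hwz : StrictlyBelow K w z) : ∃ w' ∈ U, StrictlyBelow K w' z := by
  have hopen : IsOpen {w' | StrictlyBelow K w' z} :=
    isOpen_interior.preimage (continuous_const.sub continuous_id)
  obtain ⟨w', h, hU⟩ := mem_closure_iff.1 hw _ hopen hwz
  exact ⟨w', hU, h⟩

/-- Closures are invisible to the strict order: a directed family of convex sets has an
infimum `< z` if and only if one of its members is. -/
lemma exists_strictlyBelow_mem_latticeInf_iff {K : PointedCone ℝ Z} {ι : Sort*} {A : ι → Set Z}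
    (hdir : Directed (· ⊆ ·) A) (hconv : ∀ i, Convex ℝ (A i)) {z : Z} :
    (∃ w, StrictlyBelow K w z ∧ w ∈ latticeInf A) ↔ ∃ i, ∃ w ∈ A i, StrictlyBelow K w z := by
  have hU : convexHull ℝ (⋃ i, A i) = ⋃ i, A i :=
    (hdir.convex_iUnion fun i => hconv i).convexHull_eq
  constructor
  · rintro ⟨w, hwz, hw⟩
    rw [latticeInf, hU] at hw
    obtain ⟨w', hw', h⟩ := exists_strictlyBelow_of_mem_closure hw hwz
    obtain ⟨i, hi⟩ := Set.mem_iUnion.1 hw'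
    exact ⟨i, w', hi, h⟩
  · rintro ⟨i, w, hw, h⟩
    exact ⟨w, h, subset_closure (subset_convexHull ℝ _ (Set.mem_iUnion.2 ⟨i, hw⟩))⟩

variable [ContinuousSMul ℝ Z]

lemma exists_strictlyBelow_mem_of_isOpen {K : PointedCone ℝ Z}
    (hK : (interior (K : Set Z)).Nonempty) {O : Set Z} (hO : IsOpen O) {z : Z} (hz : z ∈ O) :
    ∃ z' ∈ O, StrictlyBelow K z z' := by
  obtain ⟨k, hk⟩ := hK
  have hcont : Continuous fun c : ℝ => z + c • k := by fun_prop
  have hO' : ∀ᶠ c : ℝ in nhdsWithin 0 (Set.Ioi 0), z + c • k ∈ O := by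
    refine (hcont.tendsto 0).mono_left nhdsWithin_le_nhds (hO.mem_nhds ?_)
    simpa using hz
  obtain ⟨c, hcO, hc⟩ := (hO'.and self_mem_nhdsWithin).exists
  refine ⟨_, hcO, ?_⟩
  simpa [StrictlyBelow] using smul_mem_interior_cone hk hc

lemma apply_pos_of_mem_interior {K : PointedCone ℝ Z} {zs : WeakDual ℝ Z}
    (hzs : zs ∈ polarCone K) (hne : zs ≠ 0) {k : Z} (hk : k ∈ interior (K : Set Z)) :
    0 < zs k := by
  obtain ⟨h, hh⟩ := exists_apply_eq_one hne
  have hcont : Continuous fun c : ℝ => k - c • h := by fun_prop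
  have hO : ∀ᶠ c : ℝ in nhdsWithin 0 (Set.Ioi 0), k - c • h ∈ interior (K : Set Z) := by
    refine (hcont.tendsto 0).mono_left nhdsWithin_le_nhds (isOpen_interior.mem_nhds ?_)
    simpa using hk
  obtain ⟨c, hcO, hc⟩ := (hO.and self_mem_nhdsWithin).exists
  have := hzs _ (interior_subset hcO)
  rw [map_sub, map_smul, hh, smul_eq_mul, mul_one] at this
  exact lt_of_lt_of_le hc (by linarith)

end Image

section Separation

variable {V Z : Type*} [AddCommGroup V] [Module ℝ V] [TopologicalSpace V]
  [IsTopologicalAddGroup V] [ContinuousSMul ℝ V] [LocallyConvexSpace ℝ V]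
  [AddCommGroup Z] [Module ℝ Z] [TopologicalSpace Z]
  [IsTopologicalAddGroup Z] [ContinuousSMul ℝ Z] [LocallyConvexSpace ℝ Z]

/-! ### Separation theorems -/

lemma nonpos_and_nonneg_of_forall_pos_mul_lt {u v : ℝ} (h : ∀ c : ℝ, 0 < c → c * v < u) :
    v ≤ 0 ∧ 0 ≤ u := by
  constructor
  · by_contra! hv
    have := h ((|u| + 1) / v) (by positivity)
    rw [div_mul_cancel₀ _ hv.ne'] at this
    linarith [le_abs_self u]
  · have hcont : Filter.Tendsto (fun c : ℝ => c * v) (nhdsWithin 0 (Set.Ioi 0)) (nhds 0) := by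
      have : Continuous fun c : ℝ => c * v := by fun_prop
      simpa using (this.tendsto 0).mono_left nhdsWithin_le_nhds
    exact le_of_tendsto hcont (by filter_upwards [self_mem_nhdsWithin] with c hc using (h c hc).le)

/-- Hahn–Banach for convex sets that are monotone in the second variable: the `Z`-part of the
separating functional lies in the polar cone. -/
lemma exists_separation_of_monotone {K : PointedCone ℝ Z} {D : Set (V × Z)} (hD : Convex ℝ D)
    (hmono : ∀ v w, (v, w) ∈ D → ∀ k ∈ K, (v, w + k) ∈ D) {v₀ : V} {z₀ : Z}
    (h₀ : (v₀, z₀) ∉ closure D) :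
    ∃ (φ : V →L[ℝ] ℝ) (zs : WeakDual ℝ Z) (c : ℝ), zs ∈ polarCone K ∧
      (∀ v w, (v, w) ∈ D → c ≤ zs w - φ v) ∧ zs z₀ - φ v₀ < c := by
  rcases D.eq_empty_or_nonempty with rfl | ⟨⟨v₁, w₁⟩, h₁⟩
  · exact ⟨0, 0, 1, fun k _ => le_rfl, by simp, by simp [show (0 : WeakDual ℝ Z) z₀ = 0 from rfl]⟩
  obtain ⟨f, c, hlt, hc⟩ :=
    geometric_hahn_banach_point_closed hD.closure isClosed_closure h₀
  have hf : ∀ v w, f (v, w) = f.comp (.inr ℝ V Z) w - (-f.comp (.inl ℝ V Z)) v := by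
    intro v w
    simp [← map_add]
  refine ⟨-f.comp (.inl ℝ V Z), StrongDual.toWeakDual (f.comp (.inr ℝ V Z)), c, ?_, ?_, ?_⟩
  · intro k hk
    -- `(v₁, w₁ + r k)` lies in `D` for all `r > 0`, where the functional is bounded below
    have := (nonpos_and_nonneg_of_forall_pos_mul_lt
      (u := f (v₁, w₁) - c) (v := -(f (0, k))) fun r hr => by
        have h := hc _ (subset_closure (hmono v₁ w₁ h₁ (r • k) (PointedCone.smul_mem K hr.le hk)))
        have h2 : (v₁, w₁ + r • k) = (v₁, w₁) + r • ((0 : V), k) := by ext <;> simp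
        rw [h2, map_add, map_smul, smul_eq_mul] at h
        linarith).1
    simpa using this
  · intro v w hvw
    rw [StrongDual.toWeakDual_apply, ← hf]
    exact (hc _ (subset_closure hvw)).le
  · rw [StrongDual.toWeakDual_apply, ← hf]
    exact hlt

end Separation

section WeakStar

variable {X : Type*} [AddCommGroup X] [Module ℝ X] [TopologicalSpace X]

/-- Bipolar theorem for nonempty closed convex cones in `X* × ℝ`, with the weak-star topology
on `X*`: continuous functionals on `X*` are evaluations at points of `X`. -/
lemma exists_separation_weakDual_prod {Q : Set (WeakDual ℝ X × ℝ)} (hQ : Convex ℝ Q)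
    (hclosed : IsClosed Q) (hcone : ∀ q ∈ Q, ∀ c : ℝ, 0 < c → c • q ∈ Q) (hne : Q.Nonempty)
    {p : WeakDual ℝ X × ℝ} (hp : p ∉ Q) :
    ∃ (x : X) (β : ℝ), (∀ q ∈ Q, q.1 x ≤ β * q.2) ∧ β * p.2 < p.1 x := by
  have : LocallyConvexSpace ℝ (WeakDual ℝ X) :=
    inferInstanceAs (LocallyConvexSpace ℝ (WeakBilin (topDualPairing ℝ X)))
  obtain ⟨f, u, hlt, hu⟩ := geometric_hahn_banach_closed_point hQ hclosed hp
  obtain ⟨x, hx⟩ := LinearMap.dualEmbedding_surjective (topDualPairing ℝ X)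
    (f.comp (.inl ℝ (WeakDual ℝ X) ℝ))
  have hf : ∀ q : WeakDual ℝ X × ℝ, f q = q.1 x - (-f (0, 1)) * q.2 := by
    intro q
    have h1 : q.1 x = f (q.1, 0) := DFunLike.congr_fun hx q.1
    have h2 : q = (q.1, 0) + q.2 • ((0 : WeakDual ℝ X), (1 : ℝ)) := by ext <;> simp
    conv_lhs => rw [h2]
    rw [map_add, map_smul, h1, smul_eq_mul]
    ring
  have key : ∀ q ∈ Q, f q ≤ 0 ∧ 0 ≤ u := fun q hq =>
    nonpos_and_nonneg_of_forall_pos_mul_lt fun c hc => by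
      simpa using hlt _ (hcone q hq c hc)
  refine ⟨x, -f (0, 1), fun q hq => ?_, ?_⟩
  · have := (key q hq).1
    rw [hf] at this
    linarith
  · obtain ⟨q, hq⟩ := hne
    have := (key q hq).2.trans_lt hu
    rw [hf] at this
    linarith

end WeakStar

section ConvexFunctions

variable {X Z : Type*} [AddCommGroup X] [Module ℝ X]
  [AddCommGroup Z] [Module ℝ Z] [TopologicalSpace Z]

/-! ### Convex set-valued functions -/

lemma IsConvexFun.add_mem {F : X → Set Z} (hF : IsConvexFun F) {y₁ y₂ : X} {w₁ w₂ : Z}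
    (hw₁ : w₁ ∈ F y₁) (hw₂ : w₂ ∈ F y₂) {a : ℝ} (ha : 0 < a) (ha1 : a < 1) :
    a • w₁ + (1 - a) • w₂ ∈ F (a • y₁ + (1 - a) • y₂) :=
  hF y₁ y₂ a ha ha1 (subset_closure (subset_convexHull ℝ _
    (Set.add_mem_add (Set.smul_mem_smul_set hw₁) (Set.smul_mem_smul_set hw₂))))

lemma convex_levelSet {F : X → Set Z} (hF : IsConvexFun F) (z : Z) : Convex ℝ {x | z ∈ F x} := by
  rw [convex_iff_forall_pos]
  intro x hx y hy a b ha hb hab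
  obtain rfl : b = 1 - a := by linarith
  have := hF.add_mem hx hy ha (by linarith)
  rwa [← add_smul, add_sub_cancel, one_smul] at this

lemma convex_graph {F : X → Set Z} (hF : IsConvexFun F) : Convex ℝ {p : X × Z | p.2 ∈ F p.1} := by
  rw [convex_iff_forall_pos]
  rintro ⟨y₁, w₁⟩ hw₁ ⟨y₂, w₂⟩ hw₂ a b ha hb hab
  obtain rfl : b = 1 - a := by linarith
  exact hF.add_mem hw₁ hw₂ ha (by linarith)

end ConvexFunctions

/-- Lower level-closedness suffices: a point `(x, z)` outside the graph has some `z' > z` with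
`z' ∉ F x`, and then no `y` near `x` has a value containing a point below `z'`. -/
lemma isClosed_graph {X Z : Type*} [TopologicalSpace X]
    [AddCommGroup Z] [Module ℝ Z] [TopologicalSpace Z] [IsTopologicalAddGroup Z]
    [ContinuousSMul ℝ Z] {K : PointedCone ℝ Z}
    (hK : (interior (K : Set Z)).Nonempty) {F : X → Set Z}
    (hFm : ∀ x, F x ∈ monotoneClosedConvex K) (hcl : IsLowerLevelClosed F) :
    IsClosed {p : X × Z | p.2 ∈ F p.1} := by
  rw [← isOpen_compl_iff, isOpen_iff_mem_nhds]
  rintro ⟨x, z⟩ hz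
  obtain ⟨z', hz', hzz'⟩ := exists_strictlyBelow_mem_of_isOpen hK (hFm x).2.2.isOpen_compl hz
  have hopen : IsOpen {w | StrictlyBelow K w z'} :=
    isOpen_interior.preimage (continuous_const.sub continuous_id)
  filter_upwards [prod_mem_nhds ((hcl z').isOpen_compl.mem_nhds hz') (hopen.mem_nhds hzz')]
  rintro ⟨y, w⟩ ⟨hy, hw⟩ hwy
  exact hy (mem_of_strictlyBelow (hFm y) hwy hw)

section Conjugate

variable {X Z : Type*} [AddCommGroup X] [Module ℝ X] [TopologicalSpace X]
  [AddCommGroup Z] [Module ℝ Z] [TopologicalSpace Z]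

/-! ### The set-valued conjugate -/

lemma closedSum_negConjugate_subset {F : X → Set Z} {xs : WeakDual ℝ X} {zs : WeakDual ℝ Z}
    {c : ℝ} (hc : ∀ x, ∀ w ∈ F x, c ≤ zs w - xs x) (s : ℝ) :
    closedSum (negConjugate F xs zs) (halfSpace zs s) ⊆ halfSpace zs (c + s) := by
  refine closedSum_subset_halfSpace ?_ subset_rfl
  refine closure_minimal (convexHull_min (Set.iUnion_subset fun x => ?_) (convex_halfSpace _ _))
    (isClosed_halfSpace _ _)
  have h : F x ⊆ halfSpace zs (c + xs x) := fun w hw => by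
    have := hc x w hw
    simp only [halfSpace, Set.mem_ofPred_eq]
    linarith
  simpa using closedSum_subset_halfSpace h (subset_rfl (a := halfSpace zs (-(xs x))))

lemma mem_negConjugate {F : X → Set Z} {xs : WeakDual ℝ X} {zs : WeakDual ℝ Z} {x : X} {w z : Z}
    (hw : w ∈ F x) (hz : zs w - xs x ≤ zs z) : z ∈ negConjugate F xs zs := by
  refine subset_closure (subset_convexHull ℝ _ (Set.mem_iUnion.2 ⟨x, ?_⟩))
  refine subset_closure (subset_convexHull ℝ _ ⟨w, hw, z - w, ?_, add_sub_cancel w z⟩)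
  simp only [halfSpace, Set.mem_ofPred_eq, map_sub]
  linarith

lemma exists_lowerBound_of_negConjugate_ne_univ {F : X → Set Z} {xs : WeakDual ℝ X}
    {zs : WeakDual ℝ Z} (h : negConjugate F xs zs ≠ Set.univ) :
    ∃ c : ℝ, ∀ x, ∀ w ∈ F x, c ≤ zs w - xs x := by
  contrapose! h
  refine Set.eq_univ_of_forall fun z => ?_
  obtain ⟨x, w, hw, hlt⟩ := h (zs z)
  exact mem_negConjugate hw hlt.le

end Conjugate

section GreatestRisk

variable {X Z : Type*} [AddCommGroup X] [Module ℝ X] [TopologicalSpace X]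
  [TopologicalSpace Z]

/-! ### The greatest risk function -/

/-- The union of the values `F y` over the half space `t ≤ ⟨x*, y⟩`. -/
def superlevelImage (F : X → Set Z) (xs : WeakDual ℝ X) (t : ℝ) : Set Z :=
  {w | ∃ y, t ≤ xs y ∧ w ∈ F y}

/-- The left-continuous version of `t ↦ inf {F y : t ≤ ⟨x*, y⟩}`; for convex `F` the union
is convex, so that taking its closure gives the infimum. -/
def greatestRisk (F : X → Set Z) (xs : WeakDual ℝ X) (s : ℝ) : Set Z :=
  {z | ∀ t < s, z ∈ closure (superlevelImage F xs t)}

lemma subset_greatestRisk (F : X → Set Z) (xs : WeakDual ℝ X) {x : X} {s : ℝ} (hs : s ≤ xs x) :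
    F x ⊆ greatestRisk F xs s := fun _ hw _ ht =>
  subset_closure ⟨x, ht.le.trans hs, hw⟩

lemma greatestRisk_anti (F : X → Set Z) (xs : WeakDual ℝ X) {s t : ℝ} (hst : s ≤ t) :
    greatestRisk F xs t ⊆ greatestRisk F xs s := fun _ hz _ hr => hz _ (hr.trans_le hst)

lemma greatestRisk_leftContinuous (F : X → Set Z) (xs : WeakDual ℝ X) (s : ℝ) :
    greatestRisk F xs s = latticeSup fun t : Set.Iio s => greatestRisk F xs t := by
  refine Set.Subset.antisymm
    (Set.subset_iInter fun t => greatestRisk_anti F xs (le_of_lt t.2)) fun z hz t ht => ?_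
  obtain ⟨r, htr, hrs⟩ := exists_between ht
  exact Set.mem_iInter.1 hz ⟨r, hrs⟩ t htr

lemma greatestRisk_quasiconcave (F : X → Set Z) (xs ys : WeakDual ℝ X) (s r t : ℝ) (ht : 0 < t)
    (ht1 : t < 1) : greatestRisk F (t • xs + (1 - t) • ys) (t * s + (1 - t) * r) ⊆
      greatestRisk F xs s ∪ greatestRisk F ys r := by
  intro z hz
  by_contra! h
  simp only [Set.mem_union, not_or, greatestRisk, Set.mem_ofPred_eq, not_forall] at h
  obtain ⟨⟨a, has, ha⟩, b, hbr, hb⟩ := h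
  have h1t : 0 < 1 - t := sub_pos.2 ht1
  have hz' := hz (t * a + (1 - t) * b) (by gcongr)
  have hsub : superlevelImage F (t • xs + (1 - t) • ys) (t * a + (1 - t) * b) ⊆
      superlevelImage F xs a ∪ superlevelImage F ys b := by
    rintro w ⟨y, hy, hw⟩
    have hy' : t * a + (1 - t) * b ≤ t * xs y + (1 - t) * ys y := hy
    by_cases hxa : a ≤ xs y
    · exact Or.inl ⟨y, hxa, hw⟩
    · refine Or.inr ⟨y, ?_, hw⟩
      push Not at hxa
      have := mul_lt_mul_of_pos_left hxa ht
      exact le_of_mul_le_mul_left (by linarith) h1t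
  have := closure_mono hsub hz'
  rw [closure_union] at this
  exact this.elim ha hb

lemma greatestRisk_homogeneous (F : X → Set Z) (xs : WeakDual ℝ X) (s t : ℝ) (ht : 0 < t) :
    greatestRisk F (t • xs) s = greatestRisk F xs (s / t) := by
  have h : ∀ r, superlevelImage F (t • xs) (t * r) = superlevelImage F xs r := by
    intro r
    ext w
    refine exists_congr fun y => and_congr_left fun _ => ?_
    exact mul_le_mul_iff_right₀ (b := r) (c := xs y) ht
  ext z
  refine ⟨fun hz r hr => ?_, fun hz r hr => ?_⟩
  · rw [← h]
    exact hz _ ((lt_div_iff₀' ht).1 hr)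
  · have := hz (r / t) (div_lt_div_of_pos_right hr ht)
    rwa [← h, mul_div_cancel₀ _ ht.ne'] at this

variable [AddCommGroup Z] [Module ℝ Z]

lemma greatestRisk_subset_of_represents {K : PointedCone ℝ Z} {F : X → Set Z}
    {R : WeakDual ℝ X → ℝ → Set Z} (hR : IsRiskFunction K R) (hrep : Represents R F)
    (xs : WeakDual ℝ X) (s : ℝ) : greatestRisk F xs s ⊆ R xs s := by
  rw [hR.left_continuous]
  refine Set.subset_iInter fun t z hz => closure_minimal ?_ (hR.mem xs t).2.2 (hz t t.2)
  rintro w ⟨y, hty, hw⟩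
  rw [hrep y] at hw
  exact hR.increasing xs _ _ hty (Set.mem_iInter.1 hw xs)

lemma convex_superlevelImage {F : X → Set Z} (hF : IsConvexFun F) (xs : WeakDual ℝ X) (t : ℝ) :
    Convex ℝ (superlevelImage F xs t) := by
  rw [convex_iff_forall_pos]
  rintro w₁ ⟨y₁, h₁, hw₁⟩ w₂ ⟨y₂, h₂, hw₂⟩ a b ha hb hab
  obtain rfl : b = 1 - a := by linarith
  refine ⟨a • y₁ + (1 - a) • y₂, ?_, hF.add_mem hw₁ hw₂ ha (by linarith)⟩
  rw [map_add, map_smul, map_smul, smul_eq_mul, smul_eq_mul]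
  calc t = a * t + (1 - a) * t := by ring
    _ ≤ _ := by gcongr

variable [IsTopologicalAddGroup Z]

lemma exists_strictlyBelow_rightVersion_iff {K : PointedCone ℝ Z} {R : WeakDual ℝ X → ℝ → Set Z}
    (hR : IsRiskFunction K R) (xs : WeakDual ℝ X) (s : ℝ) (z : Z) :
    (∃ w, StrictlyBelow K w z ∧ w ∈ rightVersion R xs s) ↔
      ∃ t > s, ∃ w ∈ R xs t, StrictlyBelow K w z := by
  refine (exists_strictlyBelow_mem_latticeInf_iff
    (A := fun t : Set.Ioi s => R xs t)
    (directed_of_isDirected_ge fun _ _ hij => hR.increasing xs _ _ hij)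
    fun t => (hR.mem xs t).2.1).trans ?_
  simp

lemma exists_strictlyBelow_asymptotic_iff {K : PointedCone ℝ Z} {R : WeakDual ℝ X → ℝ → Set Z}
    (hR : IsRiskFunction K R) (xs : WeakDual ℝ X) (z : Z) :
    (∃ w, StrictlyBelow K w z ∧ w ∈ latticeInf fun s : ℝ => R xs s) ↔
      ∃ t, ∃ w ∈ R xs t, StrictlyBelow K w z :=
  exists_strictlyBelow_mem_latticeInf_iff
    (directed_of_isDirected_ge fun _ _ hij => hR.increasing xs _ _ hij)
    fun t => (hR.mem xs t).2.1

variable [ContinuousSMul ℝ Z]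

lemma isRiskFunction_greatestRisk {K : PointedCone ℝ Z} {F : X → Set Z}
    (hFm : ∀ x, F x ∈ monotoneClosedConvex K) (hF : IsConvexFun F) :
    IsRiskFunction K (greatestRisk F) where
  mem xs s := by
    have h : greatestRisk F xs s = ⋂ t < s, closure (superlevelImage F xs t) := by
      ext z
      simp [greatestRisk]
    refine mem_monotoneClosedConvex_of (fun z hz k hk t ht => ?_) ?_ ?_
    · refine map_mem_closure (f := fun z => z + k) (by fun_prop) (hz t ht) ?_
      rintro w ⟨y, hy, hw⟩
      exact ⟨y, hy, add_mem_of_mem_monotoneClosedConvex (hFm y) hw hk⟩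
    · rw [h]
      exact convex_iInter₂ fun t _ => (convex_superlevelImage hF xs t).closure
    · rw [h]
      exact isClosed_iInter fun t => isClosed_iInter fun _ => isClosed_closure
  increasing xs _ _ := greatestRisk_anti F xs
  left_continuous := greatestRisk_leftContinuous F

lemma isMaximalRiskFunction_greatestRisk {K : PointedCone ℝ Z} {F : X → Set Z}
    (hFm : ∀ x, F x ∈ monotoneClosedConvex K) (hF : IsConvexFun F) :
    IsMaximalRiskFunction K (greatestRisk F) where
  toIsRiskFunction := isRiskFunction_greatestRisk hFm hF
  quasiconcave := greatestRisk_quasiconcave F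
  homogeneous := greatestRisk_homogeneous F
  isOpen s z := by
    -- `R⁺(x*, s) < z` holds if and only if `F y < z` for some `y` with `s < ⟨x*, y⟩`
    have h : {xs : WeakDual ℝ X | ∃ w, StrictlyBelow K w z ∧
        w ∈ rightVersion (greatestRisk F) xs s} =
        ⋃ y ∈ {y | ∃ w ∈ F y, StrictlyBelow K w z}, {xs : WeakDual ℝ X | s < xs y} := by
      ext xs
      simp only [Set.mem_ofPred_eq, Set.mem_iUnion, exists_prop]
      rw [exists_strictlyBelow_rightVersion_iff (isRiskFunction_greatestRisk hFm hF)]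
      constructor
      · rintro ⟨t, hst, w, hw, hwz⟩
        obtain ⟨r, hsr, hrt⟩ := exists_between hst
        obtain ⟨w', ⟨y, hy, hw'⟩, hw'z⟩ := exists_strictlyBelow_of_mem_closure (hw r hrt) hwz
        exact ⟨y, ⟨w', hw', hw'z⟩, hsr.trans_le hy⟩
      · rintro ⟨y, ⟨w, hw, hwz⟩, hy⟩
        exact ⟨xs y, hy, w, subset_greatestRisk F xs le_rfl hw, hwz⟩
    rw [h]
    exact isOpen_biUnion fun y _ => isOpen_lt continuous_const (WeakDual.eval_continuous y)
  asymptotic := by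
    have h : ∀ xs ys : WeakDual ℝ X, (latticeInf fun s : ℝ => greatestRisk F xs s) ⊆
        latticeInf fun s : ℝ => greatestRisk F ys s := by
      intro xs ys
      refine closure_minimal (convexHull_min (Set.iUnion_subset fun s z hz => ?_)
        (convex_convexHull ℝ _).closure) isClosed_closure
      -- any threshold below `s` will do: every `F y` lies in the right-hand side
      refine closure_mono ?_ (hz (s - 1) (by linarith))
      rintro w ⟨y, -, hw⟩
      exact subset_convexHull ℝ _ (Set.mem_iUnion.2 ⟨ys y, subset_greatestRisk F ys le_rfl hw⟩)
    exact fun xs ys => (h xs ys).antisymm (h ys xs)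

/-- The right-hand side contains all half spaces `S(z*, ⟨z*, w⟩ - ⟨x*, x⟩ + s)` with `w ∈ F x`. A
point of the left-hand side is a limit of points of such half spaces, shifted along a vector `h`
with `⟨z*, h⟩ = 1`. -/
lemma greatestRisk_subset_closedSum (F : X → Set Z) (xs : WeakDual ℝ X) {zs : WeakDual ℝ Z}
    (hzs : zs ≠ 0) (s : ℝ) :
    greatestRisk F xs s ⊆ closedSum (negConjugate F xs zs) (halfSpace zs s) := by
  obtain ⟨h, hh⟩ := exists_apply_eq_one hzs
  have key : ∀ x, ∀ w ∈ F x, ∀ z, zs w - xs x + s ≤ zs z →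
      z ∈ closedSum (negConjugate F xs zs) (halfSpace zs s) := fun x w hw z hz => by
    refine subset_closure (subset_convexHull ℝ _
      ⟨z - s • h, mem_negConjugate hw ?_, s • h, ?_, sub_add_cancel _ _⟩)
    · rw [map_sub, map_smul, hh, smul_eq_mul, mul_one]
      linarith
    · simp [halfSpace, hh]
  intro z hz
  have hcont : Continuous fun c : ℝ => z + c • h := by fun_prop
  have hlim : Filter.Tendsto (fun c : ℝ => z + c • h) (nhdsWithin 0 (Set.Ioi 0)) (nhds z) := by
    simpa using (hcont.tendsto 0).mono_left nhdsWithin_le_nhds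
  refine isClosed_closure.mem_of_tendsto hlim ?_
  filter_upwards [self_mem_nhdsWithin] with c (hc : 0 < c)
  have hopen : IsOpen {w | zs w < zs z + c / 2} :=
    isOpen_lt (map_continuous zs) continuous_const
  obtain ⟨w, hwz, y, hy, hw⟩ := mem_closure_iff.1 (hz (s - c / 2) (by linarith)) _ hopen
    (by simpa using hc)
  refine key y w hw _ ?_
  rw [map_add, map_smul, hh, smul_eq_mul, mul_one]
  have : zs w < zs z + c / 2 := hwz
  linarith

/-- If `z ∉ F x`, some `z' > z` is still outside `F x`; a functional `x*` which strictly separates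
`x` from the level set of `z'` shows that `z ∉ R(x*, ⟨x*, x⟩)`. -/
lemma represents_greatestRisk [IsTopologicalAddGroup X] [ContinuousSMul ℝ X]
    [LocallyConvexSpace ℝ X] {K : PointedCone ℝ Z}
    (hK : (interior (K : Set Z)).Nonempty) {F : X → Set Z}
    (hFm : ∀ x, F x ∈ monotoneClosedConvex K) (hcl : IsLowerLevelClosed F) (hF : IsConvexFun F) :
    Represents (greatestRisk F) F := by
  refine fun x => Set.Subset.antisymm
    (Set.subset_iInter fun xs => subset_greatestRisk F xs le_rfl) fun z hz => ?_
  by_contra hzx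
  obtain ⟨z', hz', hzz'⟩ := exists_strictlyBelow_mem_of_isOpen hK (hFm x).2.2.isOpen_compl hzx
  obtain ⟨f, u, hlt, hu⟩ := geometric_hahn_banach_closed_point (convex_levelSet hF z') (hcl z') hz'
  obtain ⟨w, ⟨y, hy, hw⟩, hwz'⟩ := exists_strictlyBelow_of_mem_closure
    (Set.mem_iInter.1 hz (StrongDual.toWeakDual f) u hu) hzz'
  exact (hlt y (mem_of_strictlyBelow (hFm y) hw hwz')).not_ge hy

end GreatestRisk

section Uniqueness

variable {X Z : Type*} [AddCommGroup X] [Module ℝ X] [TopologicalSpace X]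
  [AddCommGroup Z] [Module ℝ Z] [TopologicalSpace Z]

/-! ### Uniqueness of the maximal risk function -/

/-- The points `(x*, s)` with `R⁺(x*, s) < z` form the strict hypograph of a function of `x*`.
For maximal `R` this function is sublinear and lower semicontinuous, and if `R` represents `F` it
is, for `x* ≠ 0`, at most the support function of the level set `{x : z ∈ F x}`. The condition
`R⁺(x*, s) < z` is spelled out without the closure. -/
def strictHypograph (K : PointedCone ℝ Z) (R : WeakDual ℝ X → ℝ → Set Z) (z : Z) :
    Set (WeakDual ℝ X × ℝ) :=
  {p | ∃ t > p.2, ∃ w ∈ R p.1 t, StrictlyBelow K w z}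

lemma convex_compl_strictHypograph {K : PointedCone ℝ Z} {R : WeakDual ℝ X → ℝ → Set Z}
    (hR : IsMaximalRiskFunction K R) (z : Z) : Convex ℝ (strictHypograph K R z)ᶜ := by
  rw [convex_iff_forall_pos]
  rintro ⟨xs, s⟩ hs ⟨ys, r⟩ hr a b ha hb hab ⟨t, ht, w, hw, hwz⟩
  obtain rfl : b = 1 - a := by linarith
  have ht' : a * s + (1 - a) * r < t := ht
  -- the excess of `t` over the convex combination is split evenly
  set d := t - (a * s + (1 - a) * r) with hd
  have hdt : a * (s + d) + (1 - a) * (r + d) = t := by rw [hd]; ring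
  have hd0 : 0 < d := sub_pos.2 ht'
  have hw' : w ∈ R (a • xs + (1 - a) • ys) (a * (s + d) + (1 - a) * (r + d)) := by
    rw [hdt]
    exact hw
  rcases hR.quasiconcave xs ys _ _ a ha (by linarith) hw' with h | h
  · exact hs ⟨s + d, by simpa using hd0, w, h, hwz⟩
  · exact hr ⟨r + d, by simpa using hd0, w, h, hwz⟩

lemma smul_mem_strictHypograph {K : PointedCone ℝ Z} {R : WeakDual ℝ X → ℝ → Set Z}
    (hR : IsMaximalRiskFunction K R) {z : Z} {p : WeakDual ℝ X × ℝ}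
    (hp : p ∈ strictHypograph K R z) {c : ℝ} (hc : 0 < c) : c • p ∈ strictHypograph K R z := by
  obtain ⟨t, ht, w, hw, hwz⟩ := hp
  refine ⟨c * t, mul_lt_mul_of_pos_left ht hc, w, ?_, hwz⟩
  change w ∈ R (c • p.1) (c * t)
  rwa [hR.homogeneous _ _ _ hc, mul_div_cancel_left₀ _ hc.ne']

lemma mem_of_mem_strictHypograph {K : PointedCone ℝ Z} {R : WeakDual ℝ X → ℝ → Set Z}
    (hR : IsRiskFunction K R) {z : Z} {xs : WeakDual ℝ X} {s : ℝ}
    (h : (xs, s) ∈ strictHypograph K R z) : z ∈ R xs s := by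
  obtain ⟨t, ht, w, hw, hwz⟩ := h
  exact mem_of_strictlyBelow (hR.mem xs s) (hR.increasing xs _ _ (le_of_lt ht) hw) hwz

lemma mem_of_forall_lt_mem_strictHypograph {K : PointedCone ℝ Z} {R : WeakDual ℝ X → ℝ → Set Z}
    (hR : IsRiskFunction K R) {F : X → Set Z} (hrep : Represents R F) {z : Z} {x : X}
    (h : ∀ (xs : WeakDual ℝ X), ∀ s < xs x, (xs, s) ∈ strictHypograph K R z) : z ∈ F x := by
  rw [hrep x]
  refine Set.mem_iInter.2 fun xs => ?_
  rw [hR.left_continuous]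
  exact Set.mem_iInter.2 fun s => mem_of_mem_strictHypograph hR (h xs s s.2)

variable [IsTopologicalAddGroup Z]

lemma isOpen_strictHypograph {K : PointedCone ℝ Z} {R : WeakDual ℝ X → ℝ → Set Z}
    (hR : IsMaximalRiskFunction K R) (z : Z) : IsOpen (strictHypograph K R z) := by
  rw [isOpen_iff_mem_nhds]
  rintro ⟨xs, s⟩ ⟨t, hst, w, hw, hwz⟩
  obtain ⟨r, hsr, hrt⟩ := exists_between hst
  have hopen := hR.isOpen r z
  simp only [exists_strictlyBelow_rightVersion_iff hR.toIsRiskFunction] at hopen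
  filter_upwards [prod_mem_nhds (hopen.mem_nhds ⟨t, hrt, w, hw, hwz⟩) (Iio_mem_nhds hsr)]
  rintro ⟨ys, s'⟩ ⟨⟨t', ht', h⟩, hs'⟩
  exact ⟨t', lt_trans hs' ht', h⟩

/-- A level set with nonempty strict hypograph is nonempty. The asymptotic condition puts `(0, -1)`
into the hypograph, and separating it from the complement gives a functional whose
`ℝ`-component does not vanish. -/
lemma exists_mem_of_mem_strictHypograph {K : PointedCone ℝ Z} {R : WeakDual ℝ X → ℝ → Set Z}
    (hR : IsMaximalRiskFunction K R) {F : X → Set Z} (hrep : Represents R F) {z : Z}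
    {p : WeakDual ℝ X × ℝ} (hp : p ∈ strictHypograph K R z) : ∃ x, z ∈ F x := by
  have hR' := hR.toIsRiskFunction
  have h0 : ((0 : WeakDual ℝ X), (-1 : ℝ)) ∈ strictHypograph K R z := by
    obtain ⟨t, -, w, hw, hwz⟩ := hp
    have := (exists_strictlyBelow_asymptotic_iff hR' p.1 z).2 ⟨t, w, hw, hwz⟩
    rw [hR.asymptotic p.1 0, exists_strictlyBelow_asymptotic_iff hR'] at this
    obtain ⟨t, w, hw, hwz⟩ := this
    have h1 : ((0 : WeakDual ℝ X), -(|t| + 1)) ∈ strictHypograph K R z :=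
      ⟨t, by simp only [gt_iff_lt]; linarith [neg_abs_le t], w, hw, hwz⟩
    have h2 := smul_mem_strictHypograph hR h1 (c := (|t| + 1)⁻¹) (by positivity)
    have h3 : (|t| + 1)⁻¹ • ((0 : WeakDual ℝ X), -(|t| + 1)) = (0, -1) := by
      have : |t| + 1 ≠ 0 := by positivity
      ext1
      · simp
      · simp only [Prod.smul_mk, smul_eq_mul]
        field_simp
    rwa [h3] at h2
  rcases (strictHypograph K R z)ᶜ.eq_empty_or_nonempty with he | hne
  · refine ⟨0, mem_of_forall_lt_mem_strictHypograph hR' hrep fun xs s _ => ?_⟩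
    rw [Set.compl_empty_iff.1 he]
    trivial
  obtain ⟨x, β, hQ, hβ⟩ := exists_separation_weakDual_prod (convex_compl_strictHypograph hR z)
    (isOpen_strictHypograph hR z).isClosed_compl
    (fun q hq c hc hcq => hq (by
      have := smul_mem_strictHypograph hR hcq (inv_pos.2 hc)
      rwa [inv_smul_smul₀ hc.ne'] at this)) hne (not_not.2 h0)
  have hβ0 : 0 < β := by
    have : β * -1 < 0 := hβ
    linarith
  refine ⟨β⁻¹ • x, mem_of_forall_lt_mem_strictHypograph hR' hrep fun xs s hs => ?_⟩
  by_contra hxs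
  have h1 : xs x ≤ β * s := hQ _ hxs
  rw [map_smul, smul_eq_mul, ← div_eq_inv_mul, lt_div_iff₀' hβ0] at hs
  linarith

/-- The strict hypograph of a maximal risk function is bounded by the support function of the level
set: a point separating `(x*, s)` from the complement yields, depending on whether its
`ℝ`-component vanishes, an element of the level set or a direction of recession. For `x* = 0` this
fails when the level set is all of `X` and the hypograph is everything. -/
lemma exists_lt_of_mem_strictHypograph {K : PointedCone ℝ Z} {R : WeakDual ℝ X → ℝ → Set Z}
    (hR : IsMaximalRiskFunction K R) {F : X → Set Z} (hrep : Represents R F) {z : Z}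
    {xs : WeakDual ℝ X} (hxs : xs ≠ 0) {s : ℝ} (h : (xs, s) ∈ strictHypograph K R z) :
    ∃ x, z ∈ F x ∧ s ≤ xs x := by
  have hR' := hR.toIsRiskFunction
  rcases (strictHypograph K R z)ᶜ.eq_empty_or_nonempty with he | hne
  · obtain ⟨h, hh⟩ := exists_apply_eq_one hxs
    refine ⟨s • h, mem_of_forall_lt_mem_strictHypograph hR' hrep fun ys r _ => ?_, by simp [hh]⟩
    rw [Set.compl_empty_iff.1 he]
    trivial
  obtain ⟨x, β, hQ, hβ⟩ := exists_separation_weakDual_prod (convex_compl_strictHypograph hR z)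
    (isOpen_strictHypograph hR z).isClosed_compl
    (fun q hq c hc hcq => hq (by
      have := smul_mem_strictHypograph hR hcq (inv_pos.2 hc)
      rwa [inv_smul_smul₀ hc.ne'] at this)) hne (not_not.2 h)
  have hβ0 : 0 ≤ β := by
    -- the complement is stable under increasing the second component
    obtain ⟨⟨ys, r⟩, hr⟩ := hne
    have := (nonpos_and_nonneg_of_forall_pos_mul_lt (u := β * r - ys x + 1) (v := -β)
      fun c hc => by
        have : ys x ≤ β * (r + c) := hQ (ys, r + c) fun ⟨t, ht, h⟩ =>
          hr ⟨t, lt_trans (lt_add_of_pos_right r hc) ht, h⟩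
        linarith).1
    linarith
  rcases hβ0.eq_or_lt with rfl | hβ0
  · obtain ⟨x₁, hx₁⟩ := exists_mem_of_mem_strictHypograph hR hrep h
    have hx : 0 < xs x := by simpa using hβ
    obtain ⟨c, hc0, hc⟩ : ∃ c : ℝ, 0 ≤ c ∧ s ≤ xs x₁ + c * xs x := by
      refine ⟨|s - xs x₁| / xs x, by positivity, ?_⟩
      rw [div_mul_cancel₀ _ hx.ne']
      linarith [le_abs_self (s - xs x₁)]
    refine ⟨x₁ + c • x, ?_, by simpa using hc⟩
    rw [hrep]
    refine Set.mem_iInter.2 fun ys => ?_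
    rw [hR.left_continuous]
    refine Set.mem_iInter.2 fun ⟨r, hr⟩ => ?_
    by_cases hys : (ys, r) ∈ strictHypograph K R z
    · exact mem_of_mem_strictHypograph hR' hys
    · have h1 : ys x ≤ 0 := by simpa using hQ _ hys
      have hr' : r < ys x₁ + c * ys x := by simpa using hr
      rw [hrep x₁] at hx₁
      exact hR.increasing ys _ _ (by nlinarith) (Set.mem_iInter.1 hx₁ ys)
  · refine ⟨β⁻¹ • x, mem_of_forall_lt_mem_strictHypograph hR' hrep fun ys r hr => ?_, ?_⟩
    · by_contra hys
      have h1 : ys x ≤ β * r := hQ _ hys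
      rw [map_smul, smul_eq_mul, ← div_eq_inv_mul, lt_div_iff₀' hβ0] at hr
      linarith
    · rw [map_smul, smul_eq_mul, ← div_eq_inv_mul, le_div_iff₀' hβ0]
      exact hβ.le

variable [ContinuousSMul ℝ Z]

lemma subset_greatestRisk_of_isMaximalRiskFunction {K : PointedCone ℝ Z}
    (hK : (interior (K : Set Z)).Nonempty) {R : WeakDual ℝ X → ℝ → Set Z}
    (hR : IsMaximalRiskFunction K R) {F : X → Set Z} (hrep : Represents R F) {xs : WeakDual ℝ X}
    (hxs : xs ≠ 0) (s : ℝ) : R xs s ⊆ greatestRisk F xs s := by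
  intro z hz t ht
  by_contra hzt
  obtain ⟨z', hz', hzz'⟩ :=
    exists_strictlyBelow_mem_of_isOpen hK isClosed_closure.isOpen_compl hzt
  obtain ⟨x, hx, hle⟩ := exists_lt_of_mem_strictHypograph hR hrep hxs
    (show (xs, t) ∈ strictHypograph K R z' from ⟨s, ht, z, hz, hzz'⟩)
  exact hz' (subset_closure ⟨x, hle, hx⟩)

end Uniqueness

section Duality

variable {X Z : Type*} [AddCommGroup X] [Module ℝ X] [TopologicalSpace X]
  [AddCommGroup Z] [Module ℝ Z] [TopologicalSpace Z]
  [IsTopologicalAddGroup Z] [ContinuousSMul ℝ Z]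

/-! ### Fenchel–Moreau duality for convex functions -/

lemma add_mem_polarCone_diff {K : PointedCone ℝ Z} (hK : (interior (K : Set Z)).Nonempty)
    {zs zs' : WeakDual ℝ Z} (hzs : zs ∈ polarCone K) (hzs' : zs' ∈ polarCone K \ {0}) {c : ℝ}
    (hc : 0 < c) : zs + c • zs' ∈ polarCone K \ {0} := by
  have hadd : ∀ k, (zs + c • zs') k = zs k + c * zs' k := fun k => rfl
  refine ⟨fun k hk => ?_, fun h0 => ?_⟩
  · rw [hadd]
    have := hzs k hk
    have := hzs'.1 k hk
    positivity
  · obtain ⟨k, hk⟩ := hK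
    have h1 := hzs k (interior_subset hk)
    have h2 := mul_pos hc (apply_pos_of_mem_interior hzs'.1 hzs'.2 hk)
    have h3 := hadd k
    rw [show zs + c • zs' = 0 from h0] at h3
    have h4 : (0 : WeakDual ℝ Z) k = 0 := rfl
    linarith

lemma exists_pos_mul_lt_sub {a b : ℝ} (hab : a < b) (d : ℝ) : ∃ c : ℝ, 0 < c ∧ c * d < b - a := by
  refine ⟨(b - a) / (2 * (|d| + 1)), div_pos (sub_pos.2 hab) (by positivity), ?_⟩
  rw [div_mul_eq_mul_div, div_lt_iff₀ (by positivity)]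
  have := sub_pos.2 hab
  nlinarith [le_abs_self d, abs_nonneg d]

variable [LocallyConvexSpace ℝ Z]

/-- Lagrange duality for the infimum of `F` over a half space. The given lower bound serves as a
constraint qualification: adding a small multiple of it to a separating functional makes the
multiplier of the constraint positive, and this multiplier is then normalized to `1`. -/
lemma exists_separation_of_notMem_greatestRisk {K : PointedCone ℝ Z}
    (hK : (interior (K : Set Z)).Nonempty) {F : X → Set Z}
    (hFm : ∀ x, F x ∈ monotoneClosedConvex K) (hF : IsConvexFun F) (hdom : ∃ x, F x ≠ ∅)
    {xs : WeakDual ℝ X} {zs₁ : WeakDual ℝ Z} (hzs₁ : zs₁ ∈ polarCone K \ {0}) {c₁ : ℝ}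
    (hc₁ : ∀ x, ∀ w ∈ F x, c₁ ≤ zs₁ w - xs x) {s : ℝ} {z : Z} (hz : z ∉ greatestRisk F xs s) :
    ∃ zs ∈ polarCone K \ {0}, ∃ c : ℝ, (∀ x, ∀ w ∈ F x, c ≤ zs w - xs x) ∧ zs z < c + s := by
  simp only [greatestRisk, Set.mem_ofPred_eq, not_forall] at hz
  obtain ⟨t, hts, hzt⟩ := hz
  obtain ⟨r, htr, hrs⟩ := exists_between hts
  let D : Set (ℝ × Z) := {p | ∃ x, p.1 ≤ xs x ∧ p.2 ∈ F x}
  have hD : Convex ℝ D := by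
    rw [convex_iff_forall_pos]
    rintro ⟨r₁, w₁⟩ ⟨y₁, h₁, hw₁⟩ ⟨r₂, w₂⟩ ⟨y₂, h₂, hw₂⟩ a b ha hb hab
    obtain rfl : b = 1 - a := by linarith
    refine ⟨a • y₁ + (1 - a) • y₂, ?_, hF.add_mem hw₁ hw₂ ha (by linarith)⟩
    rw [map_add, map_smul, map_smul]
    exact add_le_add (mul_le_mul_of_nonneg_left h₁ ha.le) (mul_le_mul_of_nonneg_left h₂ hb.le)
  -- the margin between `t` and `r` keeps a neighbourhood of `(r, z)` away from `D`
  have hrz : (r, z) ∉ closure D := by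
    intro h
    obtain ⟨⟨r', w⟩, ⟨hr', hw⟩, x, hx, hwx⟩ := mem_closure_iff.1 h
      (Set.Ioi t ×ˢ (closure (superlevelImage F xs t))ᶜ)
      (isOpen_Ioi.prod isClosed_closure.isOpen_compl) ⟨htr, hzt⟩
    exact hw (subset_closure ⟨x, (le_of_lt hr').trans hx, hwx⟩)
  obtain ⟨φ, zs, c, hzs, hc, hlt⟩ := exists_separation_of_monotone hD
    (fun v w ⟨x, hx, hw⟩ k hk => ⟨x, hx, add_mem_of_mem_monotoneClosedConvex (hFm x) hw hk⟩) hrz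
  have hφ : ∀ v, φ v = v * φ 1 := fun v => by
    rw [← smul_eq_mul, ← map_smul, smul_eq_mul, mul_one]
  -- `D` is stable under decreasing the first component
  have hφ1 : 0 ≤ φ 1 := by
    obtain ⟨x, hx⟩ := hdom
    obtain ⟨w, hw⟩ := Set.nonempty_iff_ne_empty.2 hx
    have := (nonpos_and_nonneg_of_forall_pos_mul_lt (u := zs w - xs x * φ 1 - c + 1) (v := -φ 1)
      fun b hb => by
        have := hc (xs x - b) w ⟨x, by simp [hb.le], hw⟩
        rw [hφ] at this
        linarith).1
    linarith
  obtain ⟨e, he, hed⟩ := exists_pos_mul_lt_sub hlt (zs₁ z - r - c₁)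
  have hl : 0 < φ 1 + e := by positivity
  have hmem := add_mem_polarCone_diff hK hzs hzs₁ he
  have hl' : 0 < (φ 1 + e)⁻¹ := inv_pos.2 hl
  have happ : ∀ w, ((φ 1 + e)⁻¹ • (zs + e • zs₁)) w = (φ 1 + e)⁻¹ * (zs w + e * zs₁ w) :=
    fun w => rfl
  refine ⟨(φ 1 + e)⁻¹ • (zs + e • zs₁), ⟨fun k hk => mul_nonneg hl'.le (hmem.1 k hk),
    smul_ne_zero hl'.ne' hmem.2⟩, (φ 1 + e)⁻¹ * (c + e * c₁), fun x w hw => ?_, ?_⟩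
  · have h1 := hc (xs x) w ⟨x, le_rfl, hw⟩
    have h2 := mul_le_mul_of_nonneg_left (hc₁ x w hw) he.le
    rw [hφ] at h1
    rw [happ, ← div_eq_inv_mul, ← div_eq_inv_mul, le_sub_iff_add_le, ← le_sub_iff_add_le',
      ← sub_div, le_div_iff₀ hl]
    linarith
  · rw [hφ] at hlt
    rw [hφ] at hed
    refine lt_trans ?_ (add_lt_add_right hrs _)
    rw [happ, ← div_eq_inv_mul, ← div_eq_inv_mul, ← sub_lt_iff_lt_add', ← sub_div,
      div_lt_iff₀ hl]
    linarith

variable [IsTopologicalAddGroup X] [ContinuousSMul ℝ X] [LocallyConvexSpace ℝ X]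

lemma exists_separation_of_notMem {K : PointedCone ℝ Z} (hK : (interior (K : Set Z)).Nonempty)
    {F : X → Set Z} (hFm : ∀ x, F x ∈ monotoneClosedConvex K) (hcl : IsLowerLevelClosed F)
    (hF : IsConvexFun F) {x₀ : X} {z₀ : Z} (hz₀ : z₀ ∉ F x₀) :
    ∃ (xs : WeakDual ℝ X) (zs : WeakDual ℝ Z) (c : ℝ), zs ∈ polarCone K ∧
      (∀ x, ∀ w ∈ F x, c ≤ zs w - xs x) ∧ zs z₀ - xs x₀ < c := by
  obtain ⟨φ, zs, c, hzs, hc, hlt⟩ := exists_separation_of_monotone (K := K) (convex_graph hF)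
    (fun v w hw k hk => add_mem_of_mem_monotoneClosedConvex (hFm v) hw hk)
    (v₀ := x₀) (z₀ := z₀) (by rwa [(isClosed_graph hK hFm hcl).closure_eq])
  exact ⟨StrongDual.toWeakDual φ, zs, c, hzs, fun x w hw => hc x w hw, hlt⟩

/-- A proper convex function has an affine minorant with a nonzero positive functional on `Z`:
above a point where `F` takes a nonempty value other than `Z`, no separating functional can be
vertical. -/
lemma exists_affine_minorant {K : PointedCone ℝ Z} (hK : (interior (K : Set Z)).Nonempty)
    {F : X → Set Z} (hFm : ∀ x, F x ∈ monotoneClosedConvex K) (hproper : IsProper F)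
    (hcl : IsLowerLevelClosed F) (hF : IsConvexFun F) :
    ∃ (xs : WeakDual ℝ X), ∃ zs ∈ polarCone K \ {0}, ∃ c : ℝ,
      ∀ x, ∀ w ∈ F x, c ≤ zs w - xs x := by
  obtain ⟨⟨x₁, hx₁⟩, huniv⟩ := hproper
  obtain ⟨w, hw⟩ := Set.nonempty_iff_ne_empty.2 hx₁
  obtain ⟨z, hz⟩ := (Set.ne_univ_iff_exists_notMem _).1 (huniv x₁)
  obtain ⟨xs, zs, c, hzs, hc, hlt⟩ := exists_separation_of_notMem hK hFm hcl hF hz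
  refine ⟨xs, zs, ⟨hzs, ?_⟩, c, hc⟩
  rintro rfl
  have h1 := hc x₁ w hw
  have h2 : (0 : WeakDual ℝ Z) w = 0 := rfl
  have h3 : (0 : WeakDual ℝ Z) z = 0 := rfl
  linarith

/-- Every point outside the graph is separated from it by an affine minorant of `F` which is
not vertical. -/
lemma exists_affine_minorant_of_notMem {K : PointedCone ℝ Z}
    (hK : (interior (K : Set Z)).Nonempty)
    {F : X → Set Z} (hFm : ∀ x, F x ∈ monotoneClosedConvex K) (hproper : IsProper F)
    (hcl : IsLowerLevelClosed F) (hF : IsConvexFun F) {x₀ : X} {z₀ : Z} (hz₀ : z₀ ∉ F x₀) :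
    ∃ (xs : WeakDual ℝ X), ∃ zs ∈ polarCone K \ {0}, ∃ c : ℝ,
      (∀ x, ∀ w ∈ F x, c ≤ zs w - xs x) ∧ zs z₀ < c + xs x₀ := by
  obtain ⟨xs₁, zs₁, hzs₁, c₁, hc₁⟩ := exists_affine_minorant hK hFm hproper hcl hF
  obtain ⟨xs, zs, c, hzs, hc, hlt⟩ := exists_separation_of_notMem hK hFm hcl hF hz₀
  obtain ⟨e, he, hed⟩ := exists_pos_mul_lt_sub hlt (zs₁ z₀ - xs₁ x₀ - c₁)
  have hx : ∀ x, (xs + e • xs₁) x = xs x + e * xs₁ x := fun x => rfl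
  have hz : ∀ z, (zs + e • zs₁) z = zs z + e * zs₁ z := fun z => rfl
  refine ⟨xs + e • xs₁, zs + e • zs₁, add_mem_polarCone_diff hK hzs hzs₁ he, c + e * c₁,
    fun x w hw => ?_, ?_⟩
  · have h1 := hc x w hw
    have h2 := mul_le_mul_of_nonneg_left (hc₁ x w hw) he.le
    rw [hx, hz]
    linarith
  · rw [hx, hz]
    linarith

end Duality

end SetValued

theorem theorem4p4 {X Z : Type*}
    [AddCommGroup X] [Module ℝ X] [TopologicalSpace X] [IsTopologicalAddGroup X]
    [ContinuousSMul ℝ X] [LocallyConvexSpace ℝ X]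
    [AddCommGroup Z] [Module ℝ Z] [TopologicalSpace Z] [IsTopologicalAddGroup Z]
    [ContinuousSMul ℝ Z] [LocallyConvexSpace ℝ Z]
    (K : PointedCone ℝ Z) (hK : (interior (K : Set Z)).Nonempty)
    (F : X → Set Z) (hF : ∀ x, F x ∈ SetValued.monotoneClosedConvex K)
    (hproper : SetValued.IsProper F) (hclosed : SetValued.IsLowerLevelClosed F)
    (hconvex : SetValued.IsConvexFun F) :
    (∀ x, F x =
      SetValued.latticeSup fun xs : WeakDual ℝ X =>
        SetValued.latticeSup fun zs : ↥(SetValued.polarCone K \ {0}) =>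
          SetValued.closedSum (SetValued.negConjugate F xs zs)
            (SetValued.halfSpace (zs : WeakDual ℝ Z) (xs x))) ∧
    ∃ R : WeakDual ℝ X → ℝ → Set Z,
      SetValued.IsMaximalRiskFunction K R ∧ SetValued.Represents R F ∧
      -- `R` is the greatest risk function that represents `F` (so it is unique)
      (∀ R' : WeakDual ℝ X → ℝ → Set Z,
        SetValued.IsRiskFunction K R' → SetValued.Represents R' F →
          ∀ xs s, R xs s ⊆ R' xs s) ∧
      -- and the only maximal one, up to its values at the zero functional
      (∀ R' : WeakDual ℝ X → ℝ → Set Z,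
        SetValued.IsMaximalRiskFunction K R' → SetValued.Represents R' F →
          ∀ xs, xs ≠ 0 → ∀ s, R' xs s = R xs s) ∧
      (∀ xs : WeakDual ℝ X,
        (∃ zs ∈ SetValued.polarCone K \ {0}, SetValued.negConjugate F xs zs ≠ Set.univ) →
        ∀ s : ℝ, R xs s =
          SetValued.latticeSup fun zs : ↥(SetValued.polarCone K \ {0}) =>
            SetValued.closedSum (SetValued.negConjugate F xs zs)
              (SetValued.halfSpace (zs : WeakDual ℝ Z) s)) := by
  have hrep := SetValued.represents_greatestRisk hK hF hclosed hconvex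
  have hmax := SetValued.isMaximalRiskFunction_greatestRisk hF hconvex
  refine ⟨fun x => Set.Subset.antisymm ?_ fun z hz => ?_, SetValued.greatestRisk F, hmax, hrep,
    fun R' hR' hrep' => SetValued.greatestRisk_subset_of_represents hR' hrep',
    fun R' hR' hrep' xs hxs s => ?_, fun xs ⟨zs₁, hzs₁, hne⟩ s => ?_⟩
  · exact Set.subset_iInter fun xs => Set.subset_iInter fun zs =>
      (SetValued.subset_greatestRisk F xs le_rfl).trans
        (SetValued.greatestRisk_subset_closedSum F xs zs.2.2 _)
  · by_contra hzx
    obtain ⟨xs, zs, hzs, c, hc, hlt⟩ :=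
      SetValued.exists_affine_minorant_of_notMem hK hF hproper hclosed hconvex hzx
    exact hlt.not_ge (SetValued.closedSum_negConjugate_subset hc _
      (Set.mem_iInter.1 (Set.mem_iInter.1 hz xs) ⟨zs, hzs⟩))
  · exact (SetValued.subset_greatestRisk_of_isMaximalRiskFunction hK hR' hrep' hxs s).antisymm
      (SetValued.greatestRisk_subset_of_represents hR'.toIsRiskFunction hrep' xs s)
  · refine Set.Subset.antisymm
      (Set.subset_iInter fun zs => SetValued.greatestRisk_subset_closedSum F xs zs.2.2 s)
      fun z hz => ?_
    by_contra hzx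
    obtain ⟨c₁, hc₁⟩ := SetValued.exists_lowerBound_of_negConjugate_ne_univ hne
    obtain ⟨zs, hzs, c, hc, hlt⟩ := SetValued.exists_separation_of_notMem_greatestRisk hK hF
      hconvex hproper.1 hzs₁ hc₁ hzx
    exact hlt.not_ge (SetValued.closedSum_negConjugate_subset hc _
      (Set.mem_iInter.1 hz ⟨zs, hzs⟩))
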